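/- Let $1 \le k < d$ be integers, let $V_{d-k}(\mathbb{R}^d) = \{\mathbf{A} \in \mathbb{R}^{(d-k)\times d} : \mathbf{A}\mathbf{A}^{\mathsf T} = \mathbf{I}\}$ and let $\Xi_k = V_{d-k}(\mathbb{R}^d) \times \mathbb{R}^{d-k}$. The orthogonal group $\mathrm{O}_{d-k}(\mathbb{R})$ acts on $\Xi_k$ by $(\mathbf{A},\mathbf{t}) \mapsto (\mathbf{U}\mathbf{A},\mathbf{U}\mathbf{t})$; two points of $\Xi_k$ lie in the same orbit exactly when they define the same $k$-plane $\{\mathbf{x} : \mathbf{A}\mathbf{x}=\mathbf{t}\}$. Let $C_{0,\mathrm{iso}}(\Xi_k)$ be the space of real continuous functions $\psi$ on $\Xi_k$ that vanish at infinity and satisfy $\psi(\mathbf{U}\mathbf{A},\mathbf{U}\mathbf{t}) = \psi(\mathbf{A},\mathbf{t})$ for all $\mathbf{U}$. Let $\mathcal{M}_{\mathrm{iso}}(\Xi_k)$ be the space of finite signed Radon measures on $\Xi_k$ that are invariant under this action, with the total variation norm $\|\cdot\|_{\mathcal M}$. For $(\mathbf{A}_0,\mathbf{t}_0) \in \Xi_k$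 let $$\delta_{\mathrm{iso}}(\cdot-(\mathbf{A}_0,\mathbf{t}_0)) = \int_{\mathrm{O}_{d-k}(\mathbb{R})} \delta_{(\mathbf{U}^{-1}\mathbf{A}_0,\,\mathbf{U}^{-1}\mathbf{t}_0)} \, d\sigma(\mathbf{U}),$$ where $\delta_{\xi}$ is the unit point mass at $\xi$ and $\sigma$ is the Haar measure of $\mathrm{O}_{d-k}(\mathbb{R})$ with total mass $1$. Then $\delta_{\mathrm{iso}}(\cdot-(\mathbf{A}_0,\mathbf{t}_0)) \in \mathcal{M}_{\mathrm{iso}}(\Xi_k)$ for every $(\mathbf{A}_0,\mathbf{t}_0)\in\Xi_k$, and the following hold. 1. Sampling: for every $\psi \in C_{0,\mathrm{iso}}(\Xi_k)$, $\langle \delta_{\mathrm{iso}}(\cdot-(\mathbf{A}_0,\mathbf{t}_0)), \psi\rangle = \psi(\mathbf{A}_0,\mathbf{t}_0)$. 2. Rotation invariance: for every $\mathbf{U} \in \mathrm{O}_{d-k}(\mathbb{R})$, $\delta_{\mathrm{iso}}(\cdot-(\mathbf{A}_0,\mathbf{t}_0)) = \delta_{\mathrm{iso}}(\cdot-(\mathbf{U}\mathbf{A}_0,\mathbf{U}\mathbf{t}_0))$.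 3. Unit norm: $\|\delta_{\mathrm{iso}}(\cdot-(\mathbf{A}_0,\mathbf{t}_0))\|_{\mathcal M} = 1$. 4. Linear combination: for all points $(\mathbf{A}_1,\mathbf{t}_1),\dots,(\mathbf{A}_N,\mathbf{t}_N) \in \Xi_k$ that lie in pairwise distinct $\mathrm{O}_{d-k}(\mathbb{R})$-orbits (that is, define pairwise distinct $k$-planes) and all $a_1,\dots,a_N \in \mathbb{R}$, $$\Bigl\|\sum_{n=1}^N a_n\, \delta_{\mathrm{iso}}(\cdot-(\mathbf{A}_n,\mathbf{t}_n))\Bigr\|_{\mathcal M} = \sum_{n=1}^N |a_n|.$$ 5. Extreme points: every extreme point of the unit ball $\{e \in \mathcal{M}_{\mathrm{iso}}(\Xi_k) : \|e\|_{\mathcal M} \le 1\}$ is of the form $\pm\delta_{\mathrm{iso}}(\cdot-(\mathbf{A}_0,\mathbf{t}_0))$ for some $(\mathbf{A}_0,\mathbf{t}_0) \in \Xi_k$. -/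

import Mathlib

open MeasureTheory

/-! ### The orthogonal group and its normalized Haar measure -/

/-- The orthogonal group `O_n(ℝ)`, with the subspace topology of the matrix space. -/
abbrev OrthGroup (n : ℕ) : Type := Matrix.orthogonalGroup (Fin n) ℝ

instance OrthGroup.instMeasurableSpace (n : ℕ) : MeasurableSpace (OrthGroup n) := borel _

instance OrthGroup.instBorelSpace (n : ℕ) : BorelSpace (OrthGroup n) := ⟨rfl⟩

theorem OrthGroup.mul_transpose_coe {n : ℕ} (U : OrthGroup n) :
    (U : Matrix (Fin n) (Fin n) ℝ) * (U : Matrix (Fin n) (Fin n) ℝ).transpose = 1 :=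
  (Matrix.mem_orthogonalGroup_iff (Fin n) ℝ).1 U.2

instance OrthGroup.instCompactSpace (n : ℕ) : CompactSpace (OrthGroup n) := by
  let S : Set (Matrix (Fin n) (Fin n) ℝ) := {M | M ∈ Matrix.orthogonalGroup (Fin n) ℝ}
  have hS : IsClosed S := by
    have h : S = {M : Matrix (Fin n) (Fin n) ℝ | M * M.transpose = 1} := by
      ext M; exact Matrix.mem_orthogonalGroup_iff (Fin n) ℝ
    rw [h]
    exact isClosed_eq (by fun_prop) continuous_const
  have hK : IsCompact
      (Set.univ.pi (fun _ => Set.univ.pi (fun _ => Set.Icc (-1 : ℝ) 1)) :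
        Set (Fin n → Fin n → ℝ)) :=
    isCompact_univ_pi (fun _ => isCompact_univ_pi (fun _ => isCompact_Icc))
  have hsub : S ⊆ (Set.univ.pi (fun _ => Set.univ.pi (fun _ => Set.Icc (-1 : ℝ) 1)) :
        Set (Fin n → Fin n → ℝ)) := by
    intro M hM i _ j _
    have h1 : (M * M.transpose) i i = 1 := by
      rw [(Matrix.mem_orthogonalGroup_iff (Fin n) ℝ).1 hM]; simp
    rw [Matrix.mul_apply] at h1
    have h2 : M i j * M i j ≤ 1 := by
      rw [← h1]
      exact Finset.single_le_sum (f := fun j => M i j * M.transpose j i)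
        (fun j _ => mul_self_nonneg (M i j)) (Finset.mem_univ j)
    exact abs_le.1 (abs_le_one_iff_mul_self_le_one.2 h2)
  exact isCompact_iff_compactSpace.1 (hK.of_isClosed_subset hS hsub)

/-- The Haar measure `σ` of `O_n(ℝ)`, normalized to total mass one. Integrals against it are
average integrals over `O_n(ℝ)`. -/
noncomputable def OrthGroup.haarProb (n : ℕ) : Measure (OrthGroup n) :=
  Measure.haarMeasure ⊤

instance OrthGroup.instIsProbabilityMeasure (n : ℕ) :
    IsProbabilityMeasure (OrthGroup.haarProb n) :=
  ⟨by simpa using! Measure.haarMeasure_self (K₀ := (⊤ : TopologicalSpace.PositiveCompacts (OrthGroup n)))⟩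

/-! ### The `k`-plane domain -/

/-- The Stiefel manifold `V_m(ℝ^d)` of real `m × d` matrices with orthonormal rows, with the
subspace topology. -/
abbrev Stiefel (m d : ℕ) : Type :=
  {A : Matrix (Fin m) (Fin d) ℝ // A * A.transpose = 1}

instance Stiefel.instSecondCountableTopology (m d : ℕ) :
    SecondCountableTopology (Stiefel m d) :=
  @TopologicalSpace.Subtype.secondCountableTopology (Matrix (Fin m) (Fin d) ℝ) _ _
    (inferInstanceAs (SecondCountableTopology (Fin m → Fin d → ℝ)))

instance Stiefel.instMeasurableSpace (m d : ℕ) : MeasurableSpace (Stiefel m d) := borel _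

instance Stiefel.instBorelSpace (m d : ℕ) : BorelSpace (Stiefel m d) := ⟨rfl⟩

/-- The `k`-plane domain `Ξ_k = V_{d-k}(ℝ^d) × ℝ^{d-k}`. Only the topology and the Borel
structure of `ℝ^{d-k}` are used. -/
abbrev KPlaneDomain (d k : ℕ) : Type := Stiefel (d - k) d × (Fin (d - k) → ℝ)

/-- The action `(A, t) ↦ (U A, U t)` of `U ∈ O_{d-k}(ℝ)` on `Ξ_k`. -/
def KPlaneDomain.rotate {d k : ℕ} (U : OrthGroup (d - k)) (ξ : KPlaneDomain d k) :
    KPlaneDomain d k :=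
  (⟨(U : Matrix (Fin (d - k)) (Fin (d - k)) ℝ) * ξ.1.1, by
      rw [Matrix.transpose_mul, Matrix.mul_assoc, ← Matrix.mul_assoc ξ.1.1, ξ.1.2,
        Matrix.one_mul, OrthGroup.mul_transpose_coe]⟩,
    Matrix.mulVec (U : Matrix (Fin (d - k)) (Fin (d - k)) ℝ) ξ.2)

/-! ### Isotropic functions and measures

`Ξ_k` is a second countable locally compact Hausdorff space, so its finite signed Borel measures
are exactly its finite (signed) Radon measures. -/

/-- Membership in `C_{0,iso}(Ξ_k)`: `ψ(U A, U t) = ψ(A, t)` for all `(A, t)` and `U`. -/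
def IsIsotropic {d k : ℕ} (ψ : ZeroAtInftyContinuousMap (KPlaneDomain d k) ℝ) : Prop :=
  ∀ (U : OrthGroup (d - k)) (ξ : KPlaneDomain d k), ψ (KPlaneDomain.rotate U ξ) = ψ ξ

/-- The space `M_iso(Ξ_k)` of finite signed measures on `Ξ_k` that are invariant under every
rotation `(A, t) ↦ (U A, U t)`. -/
def measIso (d k : ℕ) : Submodule ℝ (SignedMeasure (KPlaneDomain d k)) where
  carrier := {μ | ∀ U : OrthGroup (d - k), μ.map (KPlaneDomain.rotate U) = μ}
  zero_mem' := fun _ => VectorMeasure.map_zero _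
  add_mem' := fun hμ hν U => by rw [VectorMeasure.map_add, hμ U, hν U]
  smul_mem' := fun c μ hμ U => by rw [VectorMeasure.map_smul, hμ U]

/-- The norm of `M(Ξ_k)`: the total variation of a finite signed measure. -/
noncomputable def measNorm {d k : ℕ} (μ : SignedMeasure (KPlaneDomain d k)) : ℝ :=
  μ.totalVariation.real Set.univ

/-- The unit ball of `M_iso(Ξ_k)`. -/
def measIsoBall (d k : ℕ) : Set (SignedMeasure (KPlaneDomain d k)) :=
  {μ | μ ∈ measIso d k ∧ measNorm μ ≤ 1}

/-! ### The isotropic Dirac impulse -/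

/-- The isotropic projection of a positive measure on `Ξ_k`: the average over `U ∈ O_{d-k}(ℝ)`
of the "generalized function" `ξ ↦ μ(U ξ)`, that is, of the image of `μ` under `U⁻¹`. -/
noncomputable def isoProj {d k : ℕ} (μ : Measure (KPlaneDomain d k)) :
    Measure (KPlaneDomain d k) :=
  (OrthGroup.haarProb (d - k)).bind (fun U => μ.map (KPlaneDomain.rotate U⁻¹))

instance isoProj.instIsFiniteMeasure {d k : ℕ} (μ : Measure (KPlaneDomain d k))
    [IsFiniteMeasure μ] : IsFiniteMeasure (isoProj μ) := by
  refine ⟨(Measure.bind_apply_le _ MeasurableSet.univ).trans_lt ?_⟩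
  refine (lintegral_mono (g := fun _ => μ Set.univ) (fun U => ?_)).trans_lt ?_
  · by_cases h : AEMeasurable (KPlaneDomain.rotate U⁻¹) μ
    · rw [Measure.map_apply_of_aemeasurable h MeasurableSet.univ, Set.preimage_univ]
    · rw [Measure.map_of_not_aemeasurable h]; simp
  · simp

/-- The isotropic shifted Dirac impulse `δ_iso(· - ξ₀)`, the isotropic projection of the point
mass at `ξ₀`. -/
noncomputable def diracIso {d k : ℕ} (ξ₀ : KPlaneDomain d k) :
    SignedMeasure (KPlaneDomain d k) :=
  (isoProj (Measure.dirac ξ₀)).toSignedMeasure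

open Set
open scoped ENNReal

/-! ### The action of the orthogonal group -/

/-! The impulse at `ξ` is the image of the probability measure `σ` under `U ↦ U⁻¹ ξ`, so it is a
positive measure of mass one carried by the orbit of `ξ`. Sampling, invariance and unit norm follow
from this and the bi-invariance of `σ`. The continuous map `planeInvariant` separates orbits, so
orbits are Borel; distinct orbits are disjoint, hence the norms of impulses on distinct orbits add.

For an extreme point `e`, the norm is one and both Jordan parts are invariant
(`map_rotate_jordan_eq`). By `eq_smul_of_extreme_of_add`, a norm-additive splitting of `e` into
nonzero invariant parts has parts proportional to `e`, so one Jordan part vanishes and `±e` is an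
invariant probability measure `P`. Cutting `P` along preimages under `planeInvariant` gives a
zero-one law, so `planeInvariant` is almost surely constant and `P` lives on a single orbit.
Averaging over the group then identifies `P` with the impulse there
(`eq_isoProj_dirac_of_measure_orbit`). -/

theorem OrthGroup.transpose_mul_coe {n : ℕ} (U : OrthGroup n) :
    (U : Matrix (Fin n) (Fin n) ℝ).transpose * (U : Matrix (Fin n) (Fin n) ℝ) = 1 :=
  (Matrix.mem_orthogonalGroup_iff' (Fin n) ℝ).1 U.2

instance OrthGroup.haarProb_isHaarMeasure (n : ℕ) : (OrthGroup.haarProb n).IsHaarMeasure :=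
  inferInstanceAs (Measure.haarMeasure _).IsHaarMeasure

/-- Compact groups are unimodular: a right translate of `σ` is again a Haar probability measure, and
such a measure is unique. -/
instance OrthGroup.haarProb_isMulRightInvariant (n : ℕ) :
    (OrthGroup.haarProb n).IsMulRightInvariant where
  map_mul_right_eq_self g := by
    have : IsProbabilityMeasure (Measure.map (· * g) (OrthGroup.haarProb n)) :=
      Measure.isProbabilityMeasure_map (measurable_mul_const g).aemeasurable
    exact Measure.isHaarMeasure_eq_of_isProbabilityMeasure _ _

namespace KPlaneDomain

variable {d k : ℕ}

theorem rotate_mul (U V : OrthGroup (d - k)) (ξ : KPlaneDomain d k) :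
    rotate (U * V) ξ = rotate U (rotate V ξ) := by
  refine Prod.ext (Subtype.ext ?_) ?_
  · simp [rotate, Matrix.mul_assoc]
  · simp [rotate]

theorem rotate_one (ξ : KPlaneDomain d k) : rotate 1 ξ = ξ := by
  refine Prod.ext (Subtype.ext ?_) ?_ <;> simp [rotate]

theorem continuous_rotate_prod :
    Continuous (fun p : OrthGroup (d - k) × KPlaneDomain d k => rotate p.1 p.2) := by
  unfold rotate
  refine Continuous.prodMk (Continuous.subtype_mk ?_ _) ?_ <;> fun_prop

theorem measurable_rotate (U : OrthGroup (d - k)) :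
    Measurable (rotate U : KPlaneDomain d k → KPlaneDomain d k) :=
  (continuous_rotate_prod.comp (Continuous.prodMk_right U)).measurable

theorem measurable_rotate_inv_left (ξ : KPlaneDomain d k) :
    Measurable (fun U : OrthGroup (d - k) => rotate U⁻¹ ξ) :=
  (continuous_rotate_prod.comp (continuous_inv.prodMk continuous_const)).measurable

/-- Rotation by `U`, as a measurable equivalence of the `k`-plane domain. -/
def rotateEquiv (U : OrthGroup (d - k)) : KPlaneDomain d k ≃ᵐ KPlaneDomain d k where
  toFun := rotate U
  invFun := rotate U⁻¹
  left_inv ξ := by rw [← rotate_mul, inv_mul_cancel, rotate_one]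
  right_inv ξ := by rw [← rotate_mul, mul_inv_cancel, rotate_one]
  measurable_toFun := measurable_rotate U
  measurable_invFun := measurable_rotate U⁻¹

/-- The complete invariant `(Aᵀ A, Aᵀ t)` of the orbit of `(A, t)`: the orthogonal projection
onto the row space of `A` and the point of the plane `A x = t` closest to the origin. -/
def planeInvariant (ξ : KPlaneDomain d k) : (Fin d → Fin d → ℝ) × (Fin d → ℝ) :=
  (ξ.1.1.transpose * ξ.1.1, Matrix.mulVec ξ.1.1.transpose ξ.2)

theorem continuous_planeInvariant :
    Continuous (planeInvariant : KPlaneDomain d k → _) := by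
  unfold planeInvariant
  refine Continuous.prodMk ?_ ?_
  · exact (show Continuous fun ξ : KPlaneDomain d k => ξ.1.1.transpose * ξ.1.1 by fun_prop)
  · fun_prop

theorem planeInvariant_rotate (U : OrthGroup (d - k)) (ξ : KPlaneDomain d k) :
    planeInvariant (rotate U ξ) = planeInvariant ξ := by
  refine Prod.ext ?_ ?_
  · change (U.1 * ξ.1.1).transpose * (U.1 * ξ.1.1) = _
    rw [Matrix.transpose_mul, Matrix.mul_assoc, ← Matrix.mul_assoc _ _ ξ.1.1,
      OrthGroup.transpose_mul_coe, Matrix.one_mul]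
    rfl
  · change Matrix.mulVec (U.1 * ξ.1.1).transpose (Matrix.mulVec U.1 ξ.2) = Matrix.mulVec ξ.1.1.transpose ξ.2
    rw [Matrix.mulVec_mulVec, Matrix.transpose_mul, Matrix.mul_assoc,
      OrthGroup.transpose_mul_coe, Matrix.mul_one]

theorem exists_rotate_eq_of_planeInvariant_eq {ξ η : KPlaneDomain d k}
    (h : planeInvariant ξ = planeInvariant η) : ∃ U : OrthGroup (d - k), ξ = rotate U η := by
  obtain ⟨⟨A, hA⟩, t⟩ := ξ
  obtain ⟨⟨B, hB⟩, s⟩ := η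
  have h1 : A.transpose * A = B.transpose * B := congrArg Prod.fst h
  have h2 : Matrix.mulVec A.transpose t = Matrix.mulVec B.transpose s := congrArg Prod.snd h
  -- The rotation is forced: `A = U B` with `B Bᵀ = 1` gives `U = A Bᵀ`.
  have hU : (A * B.transpose) * (A * B.transpose).transpose = 1 := by
    rw [Matrix.transpose_mul, Matrix.transpose_transpose, Matrix.mul_assoc,
      ← Matrix.mul_assoc B.transpose, ← h1, Matrix.mul_assoc A.transpose, hA, Matrix.mul_one, hA]
  refine ⟨⟨A * B.transpose, (Matrix.mem_orthogonalGroup_iff _ ℝ).2 hU⟩,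
    Prod.ext (Subtype.ext ?_) ?_⟩
  · change A = A * B.transpose * B
    rw [Matrix.mul_assoc, ← h1, ← Matrix.mul_assoc, hA, Matrix.one_mul]
  · change t = Matrix.mulVec (A * B.transpose) s
    rw [← Matrix.mulVec_mulVec, ← h2, Matrix.mulVec_mulVec, hA, Matrix.one_mulVec]

/-- The set of all parametrizations of the `k`-plane of `ξ`. -/
def orbit (ξ : KPlaneDomain d k) : Set (KPlaneDomain d k) :=
  planeInvariant ⁻¹' {planeInvariant ξ}

theorem measurableSet_orbit (ξ : KPlaneDomain d k) : MeasurableSet (orbit ξ) :=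
  continuous_planeInvariant.measurable (measurableSet_singleton _)

theorem nonempty : Nonempty (KPlaneDomain d k) := by
  let f : Fin (d - k) → Fin d := Fin.castLE (Nat.sub_le d k)
  have hf : Function.Injective f := Fin.castLE_injective _
  refine ⟨⟨⟨Matrix.of fun i j => if f i = j then 1 else 0, ?_⟩, 0⟩⟩
  ext i j
  simp [Matrix.mul_apply, Matrix.one_apply, hf.eq_iff, eq_comm]

end KPlaneDomain

open KPlaneDomain

variable {d k : ℕ}

/-! ### The isotropic projection of a point mass -/

theorem isoProj_dirac_eq_map (ξ : KPlaneDomain d k) :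
    isoProj (Measure.dirac ξ) =
      (OrthGroup.haarProb (d - k)).map (fun U => rotate U⁻¹ ξ) := by
  have h : ∀ U : OrthGroup (d - k), (Measure.dirac ξ).map (rotate U⁻¹) =
      Measure.dirac (rotate U⁻¹ ξ) := fun U => Measure.map_dirac' (measurable_rotate _) ξ
  simp_rw [isoProj, h]
  exact Measure.bind_dirac_eq_map _ (measurable_rotate_inv_left ξ)

instance isProbabilityMeasure_isoProj_dirac (ξ : KPlaneDomain d k) :
    IsProbabilityMeasure (isoProj (Measure.dirac ξ)) := by
  rw [isoProj_dirac_eq_map]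
  exact Measure.isProbabilityMeasure_map (measurable_rotate_inv_left ξ).aemeasurable

/-- Since `V U⁻¹ = (U V⁻¹)⁻¹`, rotating after averaging is a right translation of `σ`. -/
theorem map_rotate_isoProj_dirac (V : OrthGroup (d - k)) (ξ : KPlaneDomain d k) :
    (isoProj (Measure.dirac ξ)).map (rotate V) = isoProj (Measure.dirac ξ) := by
  rw [isoProj_dirac_eq_map, Measure.map_map (measurable_rotate V) (measurable_rotate_inv_left ξ)]
  conv_rhs => rw [← map_mul_right_eq_self (OrthGroup.haarProb (d - k)) V⁻¹,
    Measure.map_map (measurable_rotate_inv_left ξ) (measurable_mul_const _)]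
  congr 1
  ext1 U
  simp [rotate_mul]

/-- Since `U⁻¹ V = (V⁻¹ U)⁻¹`, rotating before averaging is a left translation of `σ`. -/
theorem isoProj_dirac_rotate (V : OrthGroup (d - k)) (ξ : KPlaneDomain d k) :
    isoProj (Measure.dirac (rotate V ξ)) = isoProj (Measure.dirac ξ) := by
  rw [isoProj_dirac_eq_map, isoProj_dirac_eq_map]
  conv_rhs => rw [← map_mul_left_eq_self (OrthGroup.haarProb (d - k)) V⁻¹,
    Measure.map_map (measurable_rotate_inv_left ξ) (measurable_const_mul _)]
  congr 1
  ext1 U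
  simp [rotate_mul]

theorem isoProj_dirac_eq_of_mem_orbit {ξ η : KPlaneDomain d k} (h : η ∈ orbit ξ) :
    isoProj (Measure.dirac η) = isoProj (Measure.dirac ξ) := by
  obtain ⟨U, rfl⟩ := exists_rotate_eq_of_planeInvariant_eq h
  exact isoProj_dirac_rotate U ξ

theorem diracIso_rotate (U : OrthGroup (d - k)) (ξ : KPlaneDomain d k) :
    diracIso (rotate U ξ) = diracIso ξ :=
  Measure.toSignedMeasure_congr (isoProj_dirac_rotate U ξ)

theorem diracIso_orbit_self (ξ : KPlaneDomain d k) : diracIso ξ (orbit ξ) = 1 := by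
  have h : (fun U => rotate U⁻¹ ξ) ⁻¹' orbit ξ = univ :=
    eq_univ_of_forall fun U => planeInvariant_rotate _ _
  rw [diracIso, Measure.toSignedMeasure_apply_measurable (measurableSet_orbit ξ),
    measureReal_def, isoProj_dirac_eq_map,
    Measure.map_apply (measurable_rotate_inv_left ξ) (measurableSet_orbit ξ), h]
  simp

theorem diracIso_orbit_of_ne {ξ η : KPlaneDomain d k}
    (hne : planeInvariant ξ ≠ planeInvariant η) : diracIso ξ (orbit η) = 0 := by
  have h : (fun U => rotate U⁻¹ ξ) ⁻¹' orbit η = ∅ :=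
    eq_empty_of_forall_notMem fun U hU => hne ((planeInvariant_rotate U⁻¹ ξ).symm.trans hU)
  rw [diracIso, Measure.toSignedMeasure_apply_measurable (measurableSet_orbit η),
    measureReal_def, isoProj_dirac_eq_map,
    Measure.map_apply (measurable_rotate_inv_left ξ) (measurableSet_orbit η), h]
  simp

theorem integral_isoProj_dirac (ξ : KPlaneDomain d k)
    (ψ : ZeroAtInftyContinuousMap (KPlaneDomain d k) ℝ) (hψ : IsIsotropic ψ) :
    ∫ η, ψ η ∂(isoProj (Measure.dirac ξ)) = ψ ξ := by
  rw [isoProj_dirac_eq_map, integral_map (measurable_rotate_inv_left ξ).aemeasurable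
    (map_continuous ψ).aestronglyMeasurable]
  simp [hψ _ ξ]

theorem integrable_zeroAtInfty (μ : Measure (KPlaneDomain d k)) [IsFiniteMeasure μ]
    (ψ : ZeroAtInftyContinuousMap (KPlaneDomain d k) ℝ) : Integrable ψ μ :=
  Integrable.of_bound (map_continuous ψ).aestronglyMeasurable ‖ψ.toBCF‖
    (.of_forall fun x => ψ.toBCF.norm_coe_le_norm x)

/-! ### Total variation and invariance -/

theorem measNorm_eq_variation (μ : SignedMeasure (KPlaneDomain d k)) :
    measNorm μ = μ.variation.real univ := by
  rw [measNorm, SignedMeasure.totalVariation_eq_variation]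

theorem SignedMeasure.isFiniteMeasure_variation {α : Type*} [MeasurableSpace α]
    (μ : SignedMeasure α) : IsFiniteMeasure μ.variation := by
  rw [← SignedMeasure.totalVariation_eq_variation, SignedMeasure.totalVariation]
  infer_instance

theorem measNorm_zero : measNorm (0 : SignedMeasure (KPlaneDomain d k)) = 0 := by
  simp [measNorm_eq_variation]

theorem measNorm_neg (μ : SignedMeasure (KPlaneDomain d k)) : measNorm (-μ) = measNorm μ := by
  simp [measNorm_eq_variation]

theorem measNorm_smul (c : ℝ) (μ : SignedMeasure (KPlaneDomain d k)) :
    measNorm (c • μ) = |c| * measNorm μ := by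
  simp [measNorm_eq_variation, VectorMeasure.variation_smul]

theorem measNorm_toSignedMeasure (μ : Measure (KPlaneDomain d k)) [IsFiniteMeasure μ] :
    measNorm μ.toSignedMeasure = μ.real univ := by
  simp [measNorm_eq_variation]

theorem measNorm_add_le (μ ν : SignedMeasure (KPlaneDomain d k)) :
    measNorm (μ + ν) ≤ measNorm μ + measNorm ν := by
  have := SignedMeasure.isFiniteMeasure_variation μ
  have := SignedMeasure.isFiniteMeasure_variation ν
  simp only [measNorm_eq_variation]
  rw [← measureReal_add_apply]
  exact ENNReal.toReal_mono (measure_ne_top _ _) (VectorMeasure.variation_add_le univ)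

theorem measNorm_sum_le {ι : Type*} (s : Finset ι) (μ : ι → SignedMeasure (KPlaneDomain d k)) :
    measNorm (∑ i ∈ s, μ i) ≤ ∑ i ∈ s, measNorm (μ i) :=
  Finset.le_sum_of_subadditive measNorm measNorm_zero.le measNorm_add_le s μ

theorem sum_abs_le_measNorm {ι : Type*} [Fintype ι] (μ : SignedMeasure (KPlaneDomain d k))
    (S : ι → Set (KPlaneDomain d k)) (hS : ∀ i, MeasurableSet (S i))
    (hd : Pairwise (Function.onFun Disjoint S)) : ∑ i, |μ (S i)| ≤ measNorm μ := by
  have : IsFiniteMeasure μ.totalVariation := by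
    rw [SignedMeasure.totalVariation]; infer_instance
  calc ∑ i, |μ (S i)| ≤ ∑ i, μ.totalVariation.real (S i) :=
        Finset.sum_le_sum fun i _ => μ.norm_le_totalVariation (S i)
    _ = μ.totalVariation.real (⋃ i, S i) := (measureReal_iUnion_fintype hd hS).symm
    _ ≤ measNorm μ := measureReal_mono (subset_univ _)

theorem measNorm_diracIso (ξ : KPlaneDomain d k) : measNorm (diracIso ξ) = 1 := by
  rw [diracIso, measNorm_toSignedMeasure]
  simp

theorem measNorm_sum_smul_diracIso {N : ℕ} (ξ : Fin N → KPlaneDomain d k) (a : Fin N → ℝ)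
    (hξ : ∀ i j, i ≠ j → ∀ U : OrthGroup (d - k), ξ i ≠ rotate U (ξ j)) :
    measNorm (∑ n, a n • diracIso (ξ n)) = ∑ n, |a n| := by
  have hne : ∀ i j, i ≠ j → planeInvariant (ξ i) ≠ planeInvariant (ξ j) := fun i j hij h => by
    obtain ⟨U, hU⟩ := exists_rotate_eq_of_planeInvariant_eq h
    exact hξ i j hij U hU
  apply le_antisymm
  · refine (measNorm_sum_le _ _).trans_eq ?_
    simp [measNorm_smul, measNorm_diracIso]
  -- The disjoint orbits serve as test sets: the combination has mass `a n` on the orbit of `ξ n`.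
  · refine le_trans (Finset.sum_le_sum fun n _ => ?_)
      (sum_abs_le_measNorm _ (fun n => orbit (ξ n)) (fun n => measurableSet_orbit _) ?_)
    · have h : (∑ m, a m • diracIso (ξ m)) (orbit (ξ n)) = a n := by
        have h1 : (∑ m, a m • diracIso (ξ m)) (orbit (ξ n)) =
            ∑ m, a m * diracIso (ξ m) (orbit (ξ n)) := by
          simp
        rw [h1, Finset.sum_eq_single n, diracIso_orbit_self, mul_one]
        · intro m _ hm
          rw [diracIso_orbit_of_ne (hne m n hm), mul_zero]
        · simp
      rw [h]
    · intro i j hij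
      refine disjoint_left.2 fun η (hi : _ = _) (hj : _ = _) => hne i j hij (hi.symm.trans hj)

theorem toSignedMeasure_mem_measIso_iff (μ : Measure (KPlaneDomain d k)) [IsFiniteMeasure μ] :
    μ.toSignedMeasure ∈ measIso d k ↔
      ∀ U : OrthGroup (d - k), μ.map (rotate U) = μ := by
  have h : ∀ U : OrthGroup (d - k),
      μ.toSignedMeasure.map (rotate U) = (μ.map (rotate U)).toSignedMeasure := fun U => by
    ext s hs
    rw [VectorMeasure.map_apply _ (measurable_rotate U) hs,
      Measure.toSignedMeasure_apply_measurable (measurable_rotate U hs),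
      Measure.toSignedMeasure_apply_measurable hs, measureReal_def, measureReal_def,
      Measure.map_apply (measurable_rotate U) hs]
  change (∀ U : OrthGroup (d - k), μ.toSignedMeasure.map (rotate U) = μ.toSignedMeasure) ↔ _
  simp_rw [h, Measure.toSignedMeasure_eq_toSignedMeasure_iff]

theorem diracIso_mem_measIso (ξ : KPlaneDomain d k) : diracIso ξ ∈ measIso d k :=
  (toSignedMeasure_mem_measIso_iff _).2 fun U => map_rotate_isoProj_dirac U ξ

/-- A bijective bimeasurable map preserves mutual singularity, so the rotated parts form a Jordan
decomposition of the rotated measure, which is `μ` itself. Uniqueness of the decomposition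
concludes. -/
theorem map_rotate_jordan_eq {μ : SignedMeasure (KPlaneDomain d k)} (hμ : μ ∈ measIso d k)
    (U : OrthGroup (d - k)) :
    μ.toJordanDecomposition.posPart.map (rotate U) = μ.toJordanDecomposition.posPart ∧
      μ.toJordanDecomposition.negPart.map (rotate U) = μ.toJordanDecomposition.negPart := by
  let j := μ.toJordanDecomposition
  let j' : JordanDecomposition (KPlaneDomain d k) :=
    { posPart := j.posPart.map (rotate U)
      negPart := j.negPart.map (rotate U)
      posPart_finite := inferInstance
      negPart_finite := inferInstance
      mutuallySingular :=
        (rotateEquiv U).measurableEmbedding.mutuallySingular_map j.mutuallySingular }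
  have h : j'.toSignedMeasure = j.toSignedMeasure := by
    conv_rhs => rw [SignedMeasure.toSignedMeasure_toJordanDecomposition, ← hμ U,
      ← SignedMeasure.toSignedMeasure_toJordanDecomposition μ]
    ext s hs
    rw [VectorMeasure.map_apply _ (measurable_rotate U) hs, JordanDecomposition.toSignedMeasure,
      JordanDecomposition.toSignedMeasure, Measure.toSignedMeasure_sub_apply hs,
      Measure.toSignedMeasure_sub_apply (measurable_rotate U hs),
      map_measureReal_apply (measurable_rotate U) hs,
      map_measureReal_apply (measurable_rotate U) hs]
  have h2 := JordanDecomposition.toSignedMeasure_injective h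
  exact ⟨congrArg (·.posPart) h2, congrArg (·.negPart) h2⟩

/-! ### Extreme points -/

/-- Any slack `1 - measNorm e` allows moving by that multiple of an impulse in both directions
within the ball, with `e` as midpoint. -/
theorem measNorm_eq_one_of_extreme {e : SignedMeasure (KPlaneDomain d k)}
    (he : e ∈ extremePoints ℝ (measIsoBall d k)) : measNorm e = 1 := by
  obtain ⟨⟨hiso, hle⟩, hext⟩ := he
  obtain ⟨ξ⟩ := nonempty (d := d) (k := k)
  have hc : 0 ≤ 1 - measNorm e := sub_nonneg.2 hle
  have hball : ∀ c : ℝ, |c| = 1 - measNorm e → e + c • diracIso ξ ∈ measIsoBall d k :=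
    fun c hcabs => ⟨(measIso d k).add_mem hiso ((measIso d k).smul_mem c (diracIso_mem_measIso ξ)),
      (measNorm_add_le _ _).trans (by rw [measNorm_smul, measNorm_diracIso, hcabs]; linarith)⟩
  have h := hext (hball _ (abs_of_nonneg hc)) (hball _ ((abs_neg _).trans (abs_of_nonneg hc)))
    ⟨1 / 2, 1 / 2, by norm_num, by norm_num, by norm_num, by module⟩
  have h0 : measNorm ((1 - measNorm e) • diracIso ξ) = 0 := by
    rw [add_eq_left.1 h, measNorm_zero]
  rw [measNorm_smul, measNorm_diracIso, abs_of_nonneg hc] at h0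
  linarith

/-- The normalized parts lie in the ball, and `e` is their convex combination with the norms as
weights. -/
theorem eq_smul_of_extreme_of_add {e e₁ e₂ : SignedMeasure (KPlaneDomain d k)}
    (he : e ∈ extremePoints ℝ (measIsoBall d k)) (h₁ : e₁ ∈ measIso d k) (h₂ : e₂ ∈ measIso d k)
    (hadd : e₁ + e₂ = e) (hn : measNorm e₁ + measNorm e₂ = 1) (hp₁ : 0 < measNorm e₁)
    (hp₂ : 0 < measNorm e₂) : e₁ = measNorm e₁ • e ∧ e₂ = measNorm e₂ • e := by
  have hball : ∀ ν ∈ measIso d k, 0 < measNorm ν → (measNorm ν)⁻¹ • ν ∈ measIsoBall d k :=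
    fun ν hν hpos => ⟨(measIso d k).smul_mem _ hν, by
      rw [measNorm_smul, abs_of_pos (inv_pos.2 hpos), inv_mul_cancel₀ hpos.ne']⟩
  obtain ⟨h1, h2⟩ := (mem_extremePoints.1 he).2 _ (hball e₁ h₁ hp₁) _ (hball e₂ h₂ hp₂)
    ⟨measNorm e₁, measNorm e₂, hp₁, hp₂, hn, by
      rw [smul_inv_smul₀ hp₁.ne', smul_inv_smul₀ hp₂.ne', hadd]⟩
  exact ⟨by rw [← h1, smul_inv_smul₀ hp₁.ne'], by rw [← h2, smul_inv_smul₀ hp₂.ne']⟩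

/-- Averaging the invariant `P` over the group changes nothing. By Tonelli the average is also the
`P`-mixture of the impulses at `η`, and these all coincide on one orbit. -/
theorem eq_isoProj_dirac_of_measure_orbit {P : Measure (KPlaneDomain d k)}
    [IsProbabilityMeasure P] (hP : ∀ U : OrthGroup (d - k), P.map (rotate U) = P)
    {ξ : KPlaneDomain d k} (hξ : ∀ᵐ η ∂P, η ∈ orbit ξ) : P = isoProj (Measure.dirac ξ) := by
  ext s hs
  have hmeas : Measurable (fun p : OrthGroup (d - k) × KPlaneDomain d k => rotate p.1⁻¹ p.2) :=
    (continuous_rotate_prod.comp (continuous_fst.inv.prodMk continuous_snd)).measurable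
  calc P s = ∫⁻ _ : OrthGroup (d - k), P s ∂(OrthGroup.haarProb (d - k)) := by simp
    _ = ∫⁻ U, ∫⁻ η, s.indicator 1 (rotate U⁻¹ η) ∂P ∂(OrthGroup.haarProb (d - k)) := by
      refine lintegral_congr fun U => ?_
      rw [← lintegral_map (f := s.indicator 1) (measurable_one.indicator hs)
        (measurable_rotate U⁻¹), hP, lintegral_indicator_one hs]
    _ = ∫⁻ η, ∫⁻ U, s.indicator 1 (rotate U⁻¹ η) ∂(OrthGroup.haarProb (d - k)) ∂P :=
      lintegral_lintegral_swap ((measurable_one.indicator hs).comp hmeas).aemeasurable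
    _ = ∫⁻ η, isoProj (Measure.dirac η) s ∂P := by
      refine lintegral_congr fun η => ?_
      rw [isoProj_dirac_eq_map, ← lintegral_map (f := s.indicator 1)
        (measurable_one.indicator hs) (measurable_rotate_inv_left η), lintegral_indicator_one hs]
    _ = ∫⁻ _, isoProj (Measure.dirac ξ) s ∂P := by
      refine lintegral_congr_ae (hξ.mono fun η hη => ?_)
      simp only [isoProj_dirac_eq_of_mem_orbit hη]
    _ = isoProj (Measure.dirac ξ) s := by simp

theorem restrict_map_rotate {P : Measure (KPlaneDomain d k)} {U : OrthGroup (d - k)}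
    (hP : P.map (rotate U) = P) {B : Set (KPlaneDomain d k)} (hB : MeasurableSet B)
    (hinv : rotate U ⁻¹' B = B) : (P.restrict B).map (rotate U) = P.restrict B := by
  conv_rhs => rw [← hP, Measure.restrict_map (measurable_rotate U) hB, hinv]

theorem exists_eq_diracIso_of_extreme_toSignedMeasure {P : Measure (KPlaneDomain d k)}
    [IsProbabilityMeasure P] (he : P.toSignedMeasure ∈ extremePoints ℝ (measIsoBall d k)) :
    ∃ ξ : KPlaneDomain d k, P.toSignedMeasure = diracIso ξ := by
  have hP := (toSignedMeasure_mem_measIso_iff P).1 he.1.1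
  -- Zero-one law: if `B` and `Bᶜ` both had positive mass, the restrictions of `P` to them would be
  -- invariant parts with norms adding to one.
  have key : ∀ V : Set ((Fin d → Fin d → ℝ) × (Fin d → ℝ)), MeasurableSet V →
      (∀ᵐ η ∂P, planeInvariant η ∈ V) ∨ (∀ᵐ η ∂P, planeInvariant η ∉ V) := by
    intro V hV
    have hB : MeasurableSet (planeInvariant ⁻¹' V : Set (KPlaneDomain d k)) :=
      continuous_planeInvariant.measurable hV
    set B : Set (KPlaneDomain d k) := planeInvariant ⁻¹' V with hBdef
    have hinv : ∀ U : OrthGroup (d - k), rotate U ⁻¹' B = B := fun U => by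
      ext η
      simp [hBdef, planeInvariant_rotate]
    by_contra hcon
    push Not at hcon
    have hpos : 0 < P.real B := by
      refine (measureReal_nonneg).lt_of_ne' fun h0 => hcon.2 ?_
      exact measure_eq_zero_iff_ae_notMem.1 ((measureReal_eq_zero_iff).1 h0)
    have hpos' : 0 < P.real Bᶜ := by
      refine (measureReal_nonneg).lt_of_ne' fun h0 => hcon.1 ?_
      have := measure_eq_zero_iff_ae_notMem.1 ((measureReal_eq_zero_iff).1 h0)
      exact this.mono fun η hη => not_not_intro (notMem_compl_iff.1 hη)
    have hn1 : measNorm (P.restrict B).toSignedMeasure = P.real B := by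
      rw [measNorm_toSignedMeasure]; simp
    have hn2 : measNorm (P.restrict Bᶜ).toSignedMeasure = P.real Bᶜ := by
      rw [measNorm_toSignedMeasure]; simp
    have h := (eq_smul_of_extreme_of_add he
      ((toSignedMeasure_mem_measIso_iff _).2 fun U => restrict_map_rotate (hP U) hB (hinv U))
      ((toSignedMeasure_mem_measIso_iff _).2 fun U => restrict_map_rotate (hP U) hB.compl
        (by rw [preimage_compl, hinv]))
      (by rw [← Measure.toSignedMeasure_add]
          exact Measure.toSignedMeasure_congr (Measure.restrict_add_restrict_compl hB))
      (by rw [hn1, hn2, measureReal_add_measureReal_compl hB]; simp)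
      (by rwa [hn1]) (by rwa [hn2])).1
    -- On `Bᶜ` the restriction to `B` vanishes, whereas proportionality gives `P(B) P(Bᶜ) > 0`.
    have h2 := congrArg (fun ν : SignedMeasure (KPlaneDomain d k) => ν Bᶜ) h
    simp only [hn1, smul_apply,
      Measure.toSignedMeasure_apply_measurable hB.compl] at h2
    simp [measureReal_restrict_apply hB.compl] at h2
    grind
  -- The target is countably separated by Borel sets, so the zero-one law makes the invariant almost
  -- surely constant.
  obtain ⟨c, hc⟩ := Filter.exists_eventuallyEq_const_of_forall_separating
    (f := (planeInvariant : KPlaneDomain d k → _)) (l := ae P) MeasurableSet key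
  obtain ⟨ξ, hξ⟩ := hc.exists
  refine ⟨ξ, Measure.toSignedMeasure_congr (eq_isoProj_dirac_of_measure_orbit hP ?_)⟩
  exact hc.mono fun η hη => hη.trans hξ.symm

theorem neg_mem_measIsoBall {e : SignedMeasure (KPlaneDomain d k)} (he : e ∈ measIsoBall d k) :
    -e ∈ measIsoBall d k :=
  ⟨(measIso d k).neg_mem he.1, (measNorm_neg e).trans_le he.2⟩

theorem neg_mem_extremePoints {e : SignedMeasure (KPlaneDomain d k)}
    (he : e ∈ extremePoints ℝ (measIsoBall d k)) :
    -e ∈ extremePoints ℝ (measIsoBall d k) := by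
  refine mem_extremePoints.2 ⟨neg_mem_measIsoBall he.1, ?_⟩
  rintro x hx y hy ⟨a, b, ha, hb, hab, hxy⟩
  obtain ⟨h1, h2⟩ := (mem_extremePoints.1 he).2 _ (neg_mem_measIsoBall hx) _
    (neg_mem_measIsoBall hy) ⟨a, b, ha, hb, hab, by
      rw [smul_neg, smul_neg, ← neg_add, hxy, neg_neg]⟩
  exact ⟨by rw [← h1, neg_neg], by rw [← h2, neg_neg]⟩

theorem eq_diracIso_or_neg_of_extreme {e : SignedMeasure (KPlaneDomain d k)}
    (he : e ∈ extremePoints ℝ (measIsoBall d k)) :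
    ∃ ξ : KPlaneDomain d k, e = diracIso ξ ∨ e = -diracIso ξ := by
  have hnorm := measNorm_eq_one_of_extreme he
  set p := e.toJordanDecomposition.posPart with hp
  set n := e.toJordanDecomposition.negPart with hn
  have hpi : p.toSignedMeasure ∈ measIso d k :=
    (toSignedMeasure_mem_measIso_iff p).2 fun U => (map_rotate_jordan_eq he.1.1 U).1
  have hni : n.toSignedMeasure ∈ measIso d k :=
    (toSignedMeasure_mem_measIso_iff n).2 fun U => (map_rotate_jordan_eq he.1.1 U).2
  have hsub : p.toSignedMeasure - n.toSignedMeasure = e :=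
    SignedMeasure.toSignedMeasure_toJordanDecomposition e
  have hsum : p.real univ + n.real univ = 1 := by
    rw [← hnorm, measNorm, SignedMeasure.totalVariation, measureReal_add_apply]
  have hprob : ∀ μ : Measure (KPlaneDomain d k), μ.real univ = 1 → IsProbabilityMeasure μ :=
    fun μ h => ⟨(ENNReal.toReal_eq_one_iff _).1 h⟩
  rcases (measureReal_nonneg (μ := p) (s := univ)).eq_or_lt with hp0 | hp0
  · have hpz : p = 0 := Measure.measure_univ_eq_zero.1 ((measureReal_eq_zero_iff).1 hp0.symm)
    have hen : -e = n.toSignedMeasure := by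
      refine (neg_eq_iff_eq_neg.2 ?_)
      refine hsub.symm.trans ?_
      rw [Measure.toSignedMeasure_congr hpz, Measure.toSignedMeasure_zero, zero_sub]
    have := hprob n (by linarith)
    obtain ⟨ξ, hξ⟩ := exists_eq_diracIso_of_extreme_toSignedMeasure
      (hen ▸ neg_mem_extremePoints he)
    exact ⟨ξ, .inr (by rw [← hξ, ← hen, neg_neg])⟩
  rcases (measureReal_nonneg (μ := n) (s := univ)).eq_or_lt with hn0 | hn0
  · have hnz : n = 0 := Measure.measure_univ_eq_zero.1 ((measureReal_eq_zero_iff).1 hn0.symm)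
    have hep : e = p.toSignedMeasure := by
      refine hsub.symm.trans ?_
      rw [Measure.toSignedMeasure_congr hnz, Measure.toSignedMeasure_zero, sub_zero]
    have := hprob p (by linarith)
    obtain ⟨ξ, hξ⟩ := exists_eq_diracIso_of_extreme_toSignedMeasure (hep ▸ he)
    exact ⟨ξ, .inl (hep.trans hξ)⟩
  exfalso
  have hnp : measNorm p.toSignedMeasure = p.real univ := measNorm_toSignedMeasure p
  have hnn : measNorm (-n.toSignedMeasure) = n.real univ := by
    rw [measNorm_neg, measNorm_toSignedMeasure]
  obtain ⟨h1, h2⟩ := eq_smul_of_extreme_of_add he hpi ((measIso d k).neg_mem hni)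
    (by rw [← sub_eq_add_neg, hsub]) (by rw [hnp, hnn, hsum]) (by rwa [hnp]) (by rwa [hnn])
  -- With both parts nonzero, total masses give `e univ = 1` from the positive part and `e univ =
  -- -1` from the negative part.
  have h1' := congrArg (fun ν : SignedMeasure (KPlaneDomain d k) => ν univ) h1
  have h2' := congrArg (fun ν : SignedMeasure (KPlaneDomain d k) => ν univ) h2
  simp only [hnp, hnn, smul_apply, neg_apply, smul_eq_mul,
    Measure.toSignedMeasure_apply_measurable MeasurableSet.univ] at h1' h2'
  nlinarith

theorem mainTheorem12 (d k : ℕ) (hk : 1 ≤ k) (hkd : k < d) :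
    -- membership in `M_iso(Ξ_k)`
    (∀ ξ₀ : KPlaneDomain d k, diracIso ξ₀ ∈ measIso d k) ∧
    -- sampling
    (∀ (ξ₀ : KPlaneDomain d k) (ψ : ZeroAtInftyContinuousMap (KPlaneDomain d k) ℝ),
      IsIsotropic ψ →
        (diracIso ξ₀).Integrable (fun ξ => ψ ξ) ∧ ∫ᵛ ξ, ψ ξ ∂<•(diracIso ξ₀) = ψ ξ₀) ∧
    -- rotation invariance
    (∀ (ξ₀ : KPlaneDomain d k) (U : OrthGroup (d - k)),
      diracIso ξ₀ = diracIso (KPlaneDomain.rotate U ξ₀)) ∧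
    -- unit norm
    (∀ ξ₀ : KPlaneDomain d k, measNorm (diracIso ξ₀) = 1) ∧
    -- linear combinations at points that represent pairwise distinct `k`-planes
    (∀ (N : ℕ) (ξ : Fin N → KPlaneDomain d k) (a : Fin N → ℝ),
      (∀ i j, i ≠ j → ∀ U : OrthGroup (d - k), ξ i ≠ KPlaneDomain.rotate U (ξ j)) →
        measNorm (∑ n, a n • diracIso (ξ n)) = ∑ n, |a n|) ∧
    -- extreme points of the unit ball of `M_iso(Ξ_k)`
    (∀ e ∈ Set.extremePoints ℝ (measIsoBall d k),
      ∃ ξ₀ : KPlaneDomain d k, e = diracIso ξ₀ ∨ e = -diracIso ξ₀) := by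
  refine ⟨diracIso_mem_measIso, fun ξ₀ ψ hψ => ⟨?_, ?_⟩, fun ξ₀ U => (diracIso_rotate U ξ₀).symm,
    measNorm_diracIso, fun N ξ a hξ => measNorm_sum_smul_diracIso ξ a hξ,
    fun e he => eq_diracIso_or_neg_of_extreme he⟩
  · rw [VectorMeasure.Integrable, diracIso, Measure.variation_toSignedMeasure]
    exact integrable_zeroAtInfty _ ψ
  · rw [diracIso, VectorMeasure.integral_toSignedMeasure]
    exact integral_isoProj_dirac ξ₀ ψ hψ
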